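/- Let $\mathbb{K}$ be an algebraically closed field of characteristic zero. For an algebraic variety $Z$ over $\mathbb{K}$ let $\mathrm{Aut}(Z)$ be its group of automorphisms over $\mathbb{K}$, acting on the set of ($\mathbb{K}$-)points of $Z$, and let $\mathbb{K}[Z]$ be its algebra of regular functions. The variety $Z$ is called homogeneous if $\mathrm{Aut}(Z)$ acts transitively on its points. The transitivity degree $\theta(Z)\in\{0,1,2,\ldots,\infty\}$ is the maximal number $m$, not exceeding the number of points of $Z$, such that any $m$-tuple of pairwise distinct points of $Z$ can be mapped to any other such $m$-tuple by an element of $\mathrm{Aut}(Z)$; it is $0$ if the action is not transitive, and $\infty$ if there is no maximal such $m$. Let $X$ and $Y$ be irreducible homogeneous algebraic varieties over $\mathbb{K}$ of positive dimension. Assume that $X$ is quasi-affine and $\mathbb{K}[Y]=\mathbb{K}$. Then $\theta(X\times Y)=1$. -/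

import Mathlib

open AlgebraicGeometry CategoryTheory MonoidalCategory

universe u

/-- The transitivity degree of a group action: the maximal number `m` such that `G` acts
transitively on `m`-tuples of pairwise distinct points of `α`, or `⊤` if there is no maximal such
number. Only those `m` count for which such tuples exist, so that a symmetric group acting on a
set with `n` elements has transitivity degree `n`. The degree is `0` if the action is not
transitive. -/
noncomputable def transitivityDegree (G α : Type*) [Group G] [MulAction G α] : ℕ∞ :=
  sSup {d : ℕ∞ | ∃ m : ℕ, d = m ∧ (m : ℕ∞) ≤ ENat.card α ∧
    MulAction.IsMultiplyPretransitive G α m}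

namespace Variety

variable {K : Type u} [Field K]

/-- A `K`-scheme is an algebraic variety if it is reduced, separated and of finite type over `K`
(it may be reducible). -/
class IsAlgebraicVariety (X : Over (Spec (CommRingCat.of K))) : Prop where
  isReduced : IsReduced X.left
  isSeparated : IsSeparated X.hom
  locallyOfFiniteType : LocallyOfFiniteType X.hom
  quasiCompact : QuasiCompact X.hom

/-- The set of points `X(K)` of a `K`-scheme. When `K` is algebraically closed and `X` is a
variety, these are the points of `X` in the classical sense, i.e. the closed points of the
scheme. -/
def Points (X : Over (Spec (CommRingCat.of K))) : Type u :=
  Over.mk (𝟙 (Spec (CommRingCat.of K))) ⟶ X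

/-- The map on points induced by a morphism of `K`-schemes. -/
noncomputable def Points.map {X Y : Over (Spec (CommRingCat.of K))} (f : X ⟶ Y) (p : Points X) :
    Points Y :=
  CategoryStruct.comp (X := Over.mk (𝟙 (Spec (CommRingCat.of K)))) p f

/-- The group of automorphisms of `X` over `K` acts on the points of `X`. -/
noncomputable instance (X : Over (Spec (CommRingCat.of K))) : MulAction (Aut X) (Points X) where
  smul g p := p.map g.hom
  one_smul p := Category.comp_id (X := Over.mk (𝟙 (Spec (CommRingCat.of K)))) p
  mul_smul g h p :=
    (Category.assoc (W := Over.mk (𝟙 (Spec (CommRingCat.of K)))) p h.hom g.hom).symm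

/-- `X` is homogeneous if `Aut X` acts transitively on the points of `X`. -/
def IsHomogeneous (X : Over (Spec (CommRingCat.of K))) : Prop :=
  MulAction.IsPretransitive (Aut X) (Points X)

/-- The transitivity degree `θ(X)`. -/
noncomputable def theta (X : Over (Spec (CommRingCat.of K))) : ℕ∞ :=
  transitivityDegree (Aut X) (Points X)

/-- The inclusion of the constants `K` into the ring `K[X]` of regular functions on `X`. -/
noncomputable def constants (X : Over (Spec (CommRingCat.of K))) : K →+* Γ(X.left, ⊤) :=
  ((Scheme.ΓSpecIso (CommRingCat.of K)).inv ≫ X.hom.appTop).hom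

end Variety

open CartesianMonoidalCategory

/-! Call two points functionally equal if every regular function agrees on them; morphisms preserve
this relation. It is equality on the quasi-affine `X`, and relates any two points of `Y` since `K[Y]
= K`. So `(x, y)` and `(x, y')` are related, through the slice `{x} × Y`, while `(x, y)` and `(x',
y)` are not, by projecting to `X`. No automorphism takes the first pair to the second; transitivity
comes from products of automorphisms. -/

theorem transitivityDegree_eq_one {G α : Type*} [Group G] [MulAction G α] [Nonempty α]
    (h₁ : MulAction.IsPretransitive G α) (h₂ : ¬ MulAction.IsMultiplyPretransitive G α 2) :
    transitivityDegree G α = 1 := by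
  apply le_antisymm
  · refine sSup_le ?_
    rintro d ⟨m, rfl, hm, hmt⟩
    by_contra hlt
    have h2m : 2 ≤ m := by
      have : (1 : ℕ∞) < m := not_le.mp hlt
      exact_mod_cast this
    -- The bound `hm` matters: without `m` distinct points, `m`-transitivity is vacuous and does not
    -- descend to `2`.
    exact h₂ (MulAction.isMultiplyPretransitive_of_le' h2m hm)
  · refine le_sSup ⟨1, by simp, ?_, ?_⟩
    · rw [Nat.cast_one, ENat.one_le_card_iff_nonempty]; infer_instance
    · exact MulAction.is_one_pretransitive_iff.mpr h₁

/-- A Jacobson space of positive dimension has two distinct closed points. -/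
theorem exists_ne_closedPoints {T : Type*} [TopologicalSpace T] [JacobsonSpace T]
    (h : 0 < topologicalKrullDim T) :
    ∃ x y : T, IsClosed {x} ∧ IsClosed {y} ∧ x ≠ y := by
  obtain ⟨Z₀, Z₁, hlt⟩ : ∃ Z₀ Z₁ : TopologicalSpace.IrreducibleCloseds T, Z₀ < Z₁ := by
    simpa [topologicalKrullDim] using Order.krullDim_pos_iff.mp h
  have hd (Z : TopologicalSpace.IrreducibleCloseds T) :
      closure ((Z : Set T) ∩ closedPoints T) = Z :=
    JacobsonSpace.closure_inter_closedPoints Z.isClosed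
  have hn : ((Z₀ : Set T) ∩ closedPoints T).Nonempty := by
    rw [← closure_nonempty_iff, hd]
    exact Z₀.isIrreducible.nonempty
  obtain ⟨x, hx, hxc⟩ := hn
  by_contra! hall
  -- If `x` is the only closed point, then `Z₀` contains the closed points of `Z₁`, which are dense
  -- in `Z₁`.
  have hsub : (Z₁ : Set T) ∩ closedPoints T ⊆ Z₀ := by
    rintro y ⟨-, hyc⟩
    rwa [← hall x y hxc hyc]
  have : Z₁ ≤ Z₀ := by
    change (Z₁ : Set T) ⊆ Z₀
    rw [← hd Z₁]
    exact closure_minimal hsub Z₀.isClosed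
  exact hlt.not_ge this

namespace Variety

variable {K : Type u} [Field K]

/-- Two points are functionally equal if all regular functions agree on them. -/
def FunctionallyEq {X : Over (Spec (CommRingCat.of K))} (p q : Points X) : Prop :=
  p.left.appTop = q.left.appTop

theorem FunctionallyEq.map {X Y : Over (Spec (CommRingCat.of K))} {p q : Points X}
    (h : FunctionallyEq p q) (f : X ⟶ Y) : FunctionallyEq (p.map f) (q.map f) := by
  change (p.left ≫ f.left).appTop = (q.left ≫ f.left).appTop
  rw [Scheme.Hom.comp_appTop, Scheme.Hom.comp_appTop]
  exact congrArg (f.left.appTop ≫ ·) h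

/-- The canonical map `X ⟶ Spec Γ(X)` is a monomorphism, and its composite with a point depends only
on the pullback of functions. -/
theorem FunctionallyEq.eq_of_isQuasiAffine {X : Over (Spec (CommRingCat.of K))}
    (hX : X.left.IsQuasiAffine) {p q : Points X} (h : FunctionallyEq p q) : p = q := by
  have : p.left = q.left := by
    rw [← cancel_mono X.left.toSpecΓ, Scheme.toSpecΓ_naturality, Scheme.toSpecΓ_naturality]
    exact congrArg (_ ≫ Spec.map ·) h
  exact Over.OverMorphism.ext this

/-- A point is a section of the structure morphism, so all points pull constants back in the same
way. -/
theorem functionallyEq_of_surjective_constants {Y : Over (Spec (CommRingCat.of K))}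
    (hY : Function.Surjective (constants Y)) (p q : Points Y) : FunctionallyEq p q := by
  have key (r : Points Y) : Y.hom.appTop ≫ r.left.appTop = 𝟙 _ := by
    rw [← Scheme.Hom.comp_appTop, Over.w r]
    rfl
  change p.left.appTop = q.left.appTop
  ext f
  obtain ⟨c, rfl⟩ := hY f
  have := (key p).trans (key q).symm
  exact congrArg (fun φ ↦ φ.hom ((Scheme.ΓSpecIso (CommRingCat.of K)).inv.hom c)) this

/-- The point `(p, q)` of a product. -/
noncomputable def Points.prod {X Y : Over (Spec (CommRingCat.of K))} (p : Points X)
    (q : Points Y) : Points (X ⊗ Y) :=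
  lift (T := Over.mk (𝟙 (Spec (CommRingCat.of K)))) p q

theorem Points.prod_map_fst {X Y : Over (Spec (CommRingCat.of K))} (p : Points X)
    (q : Points Y) : (p.prod q).map (fst X Y) = p :=
  lift_fst (T := Over.mk (𝟙 (Spec (CommRingCat.of K)))) p q

theorem Points.prod_map_snd {X Y : Over (Spec (CommRingCat.of K))} (p : Points X)
    (q : Points Y) : (p.prod q).map (snd X Y) = q :=
  lift_snd (T := Over.mk (𝟙 (Spec (CommRingCat.of K)))) p q

theorem Points.eq_prod {X Y : Over (Spec (CommRingCat.of K))} (r : Points (X ⊗ Y)) :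
    r = (r.map (fst X Y)).prod (r.map (snd X Y)) :=
  (lift_comp_fst_snd (X := Over.mk (𝟙 (Spec (CommRingCat.of K)))) r).symm

theorem Points.prod_map_tensorHom {X Y X' Y' : Over (Spec (CommRingCat.of K))} (p : Points X)
    (q : Points Y) (f : X ⟶ X') (g : Y ⟶ Y') :
    (p.prod q).map (f ⊗ₘ g) = (p.map f).prod (q.map g) :=
  lift_map (V := Over.mk (𝟙 (Spec (CommRingCat.of K)))) p q f g

/-- The inclusion of the slice `{p} × Y`. -/
noncomputable def slice {X : Over (Spec (CommRingCat.of K))} (p : Points X)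
    (Y : Over (Spec (CommRingCat.of K))) : Y ⟶ X ⊗ Y :=
  lift (Over.homMk (V := Over.mk (𝟙 _)) Y.hom (Category.comp_id _) ≫ p) (𝟙 Y)

theorem map_slice {X Y : Over (Spec (CommRingCat.of K))} (p : Points X) (q : Points Y) :
    q.map (slice p Y) = p.prod q := by
  have aux (p : Over.mk (𝟙 (Spec (CommRingCat.of K))) ⟶ X)
      (q : Over.mk (𝟙 (Spec (CommRingCat.of K))) ⟶ Y) :
      q ≫ lift (Over.homMk (V := Over.mk (𝟙 _)) Y.hom (Category.comp_id _) ≫ p) (𝟙 Y) =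
        lift p q := by
    have hq : q ≫ Over.homMk (V := Over.mk (𝟙 _)) Y.hom (Category.comp_id _) = 𝟙 _ :=
      Over.OverMorphism.ext (Over.w q)
    rw [comp_lift, ← Category.assoc, hq, Category.id_comp, Category.comp_id]
  exact aux p q

theorem IsHomogeneous.prod {X Y : Over (Spec (CommRingCat.of K))} (hX : IsHomogeneous X)
    (hY : IsHomogeneous Y) : IsHomogeneous (X ⊗ Y) := by
  refine ⟨fun r s ↦ ?_⟩
  obtain ⟨g, hg⟩ := hX.exists_smul_eq (r.map (fst X Y)) (s.map (fst X Y))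
  obtain ⟨h, hh⟩ := hY.exists_smul_eq (r.map (snd X Y)) (s.map (snd X Y))
  refine ⟨tensorIso g h, ?_⟩
  change r.map (g.hom ⊗ₘ h.hom) = s
  rw [r.eq_prod, Points.prod_map_tensorHom, s.eq_prod]
  exact congrArg₂ Points.prod hg hh

/-- Closed points are `K`-rational because `K` is algebraically closed, so two distinct ones
suffice. -/
theorem exists_ne_points [IsAlgClosed K] (X : Over (Spec (CommRingCat.of K)))
    [IsAlgebraicVariety X] (hX : 0 < topologicalKrullDim X.left) :
    ∃ p q : Points X, p ≠ q := by
  have := IsAlgebraicVariety.locallyOfFiniteType (X := X)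
  have : JacobsonSpace X.left := LocallyOfFiniteType.jacobsonSpace X.hom
  obtain ⟨x, y, hx, hy, hxy⟩ := exists_ne_closedPoints hX
  let P (z : X.left) (hz : IsClosed {z}) : Points X :=
    Over.homMk (U := Over.mk (𝟙 (Spec (CommRingCat.of K)))) (pointOfClosedPoint X.hom z hz)
      (pointOfClosedPoint_comp X.hom z hz)
  have hP (z : X.left) (hz : IsClosed {z}) : (P z hz).left (IsLocalRing.closedPoint K) = z :=
    pointOfClosedPoint_apply X.hom z hz _
  refine ⟨P x hx, P y hy, fun e ↦ hxy ?_⟩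
  rw [← hP x hx, ← hP y hy, e]

end Variety

theorem corollary3p4 {K : Type u} [Field K] [IsAlgClosed K] [CharZero K]
    (X Y : Over (Spec (CommRingCat.of K)))
    [Variety.IsAlgebraicVariety X] [Variety.IsAlgebraicVariety Y]
    [IrreducibleSpace X.left] [IrreducibleSpace Y.left]
    (hX : Variety.IsHomogeneous X) (hY : Variety.IsHomogeneous Y)
    (hdimX : 0 < topologicalKrullDim X.left) (hdimY : 0 < topologicalKrullDim Y.left)
    (hqa : X.left.IsQuasiAffine)
    (hconst : Function.Bijective (Variety.constants Y)) :
    Variety.theta (X ⊗ Y) = 1 := by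
  obtain ⟨x, x', hx⟩ := Variety.exists_ne_points X hdimX
  obtain ⟨y, y', hy⟩ := Variety.exists_ne_points Y hdimY
  have : Nonempty (Variety.Points (X ⊗ Y)) := ⟨x.prod y⟩
  refine transitivityDegree_eq_one (hX.prod hY) fun h ↦ hx ?_
  -- `g` would fix `(x, y)` and send `(x, y')` to `(x', y)`.
  obtain ⟨g, hg, hg'⟩ := MulAction.is_two_pretransitive_iff.mp h
    (show x.prod y ≠ x.prod y' from fun e ↦ hy (by
      simpa only [Variety.Points.prod_map_snd] using congrArg (Variety.Points.map (snd X Y)) e))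
    (show x.prod y ≠ x'.prod y from fun e ↦ hx (by
      simpa only [Variety.Points.prod_map_fst] using congrArg (Variety.Points.map (fst X Y)) e))
  have hE := (((Variety.functionallyEq_of_surjective_constants hconst.2 y y').map
    (Variety.slice x Y)).map g.hom).map (fst X Y)
  rw [Variety.map_slice, Variety.map_slice] at hE
  change Variety.FunctionallyEq (Variety.Points.map _ (g • _)) (Variety.Points.map _ (g • _)) at hE
  rw [hg, hg', Variety.Points.prod_map_fst, Variety.Points.prod_map_fst] at hE
  exact hE.eq_of_isQuasiAffine hqa
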